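/- Let $G$ be a finite simple graph that is co-bipartite, i.e. whose complement is bipartite. Then the following are equivalent: (1) $G$ is $1$-perfectly orientable, that is, $G$ has an orientation (an assignment of exactly one direction to each edge) in which the out-neighborhood of every vertex induces a tournament (an orientation of a complete graph); (2) $G$ has an orientation in which every induced $4$-cycle of $G$ is oriented cyclically, that is, every vertex of the cycle has exactly one out-neighbor on the cycle; (3) $G$ is a circular arc graph, that is, the intersection graph of a family of closed arcs on a circle: to each vertex $v$ one can assign a closed arc $A_v$ of a fixed circle so that distinct vertices $u,v$ are adjacent if and only if $A_u\cap A_v\neq\emptyset$. -/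

import Mathlib

/-- `D` is an orientation of the simple graph `G`: it is obtained by assigning exactly one of the
two possible directions to each edge of `G` (in particular `D` has no loops and no other arcs). -/
def Digraph.IsOrientationOf {V : Type*} (D : Digraph V) (G : SimpleGraph V) : Prop :=
  (∀ u v, G.Adj u v ↔ D.Adj u v ∨ D.Adj v u) ∧ ∀ u v, D.Adj u v → ¬ D.Adj v u

/-- The out-neighborhood of `v` in the digraph `D`. -/
def Digraph.outNbhd {V : Type*} (D : Digraph V) (v : V) : Set V :=
  {w | D.Adj v w}

/-- The subdigraph of `D` induced by a set `S` of vertices. -/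
def Digraph.inducedOn {V : Type*} (D : Digraph V) (S : Set V) : Digraph S where
  Adj x y := D.Adj x y

/-- A tournament is an orientation of a complete graph. -/
def Digraph.IsTournament {V : Type*} (D : Digraph V) : Prop :=
  D.IsOrientationOf (⊤ : SimpleGraph V)

/-- `G` is 1-perfectly orientable: it has an orientation in which the out-neighborhood of every
vertex induces a tournament. -/
def SimpleGraph.IsOnePerfectlyOrientable {V : Type*} (G : SimpleGraph V) : Prop :=
  ∃ D : Digraph V, D.IsOrientationOf G ∧ ∀ v, (D.inducedOn (D.outNbhd v)).IsTournament

/-- The induced (chordless) cycle of `G` with vertices `f 0, …, f (n - 1)` is oriented cyclically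
in `D`: every vertex of the cycle has exactly one out-neighbor on the cycle. -/
def SimpleGraph.IsCyclicallyOriented {V : Type*} {G : SimpleGraph V} {n : ℕ}
    (f : SimpleGraph.cycleGraph n ↪g G) (D : Digraph V) : Prop :=
  ∀ i, ∃! j, D.Adj (f i) (f j)

/-- `G` is co-bipartite: its complement is bipartite. -/
def SimpleGraph.IsCoBipartite {V : Type*} (G : SimpleGraph V) : Prop :=
  Gᶜ.IsBipartite

/-- A closed arc of the circle `ℝ / ℤ`: the image of a nonempty compact interval of the real line
under the quotient map `ℝ → ℝ / ℤ`. (Single points and the whole circle are included.) -/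
def IsClosedArc (S : Set UnitAddCircle) : Prop :=
  ∃ a b : ℝ, a ≤ b ∧ S = (fun x : ℝ => (x : UnitAddCircle)) '' Set.Icc a b

/-- `G` is a circular arc graph: it is the intersection graph of a family of closed arcs on a
circle. -/
def SimpleGraph.IsCircularArc {V : Type*} (G : SimpleGraph V) : Prop :=
  ∃ A : V → Set UnitAddCircle, (∀ v, IsClosedArc (A v)) ∧
    ∀ u v, u ≠ v → (G.Adj u v ↔ (A u ∩ A v).Nonempty)

/-!
Write the co-bipartite graph as two cliques `A`, `B` and let `E ⊆ A × B` be the adjacency between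
them. Two pairs `(a, b)`, `(a', b')` of `E` *conflict* if `(a, b')` and `(a', b)` are not in `E`;
the four vertices then span an induced 4-cycle, and every induced 4-cycle has this form.

* A circular arc graph is 1-perfectly orientable: let `u` point to `v` when the arc of `v` contains
  the last point of the arc of `u`. The arcs of the out-neighbors of `u` share that point
  (`SimpleGraph.IsCircularArc.isOnePerfectlyOrientable`).
* If out-neighborhoods are cliques, then no vertex of an induced 4-cycle has two out-neighbors on
  it, so each has exactly one (`exists_cyclic_orientation_of_isOnePerfectlyOrientable`).
* In an orientation with cyclic induced 4-cycles, the direction of the edge `ab` is a 2-coloring of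
  `E` in which conflicting pairs differ (`orientation_ne_of_conflict`). A theorem of Cogis on
  relations of Ferrers dimension two then gives functions into `ℕ` with
  `E a b ↔ L b ≤ l a ∨ R b ≤ r a` (`exists_two_threshold_representation`). Put all arcs of `A`
  around the point `0` and all arcs of `B` around the point `1/2`; the two inequalities say
  that the arcs of `a` and `b` meet on one or on the other side
  (`isCircularArc_of_threshold_representation`).

The theorem of Cogis is proved by a lexicographic choice of the coloring. For one color, let
`a < a'` if some `b` has `¬ E a b`, while `E a' b` holds and no pair of that color conflicts with
`(a', b)`. This is a strict partial order unless there are three non-related pairs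
`(x₁, y₁)`, `(x₂, y₂)`, `(x₃, y₃)` such that all other `(xᵢ, yⱼ)` are related and
`(x₁, y₂)`, `(x₂, y₃)`, `(x₃, y₁)` have one color (`CyclicTriple`). If `(x₂, y₃)` is moved inside
its component of the conflict graph, the triple can be moved along with `(x₁, y₁)` fixed
(`CyclicTriple.exists_of_linked`). Consequently, if the colors of the components are chosen so that
every component has a pair of color `true` with the least first coordinate, there is no cyclic triple
(`not_cyclicTriple_of_normalized`).
-/

/-! ### Two-valued colors -/

theorem Bool.beq_left_injective (c : Bool) : Function.Injective fun a : Bool => a == c := by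
  decide +revert

theorem Bool.eq_of_ne_of_ne {a b c : Bool} (hab : a ≠ c) (hbc : b ≠ c) : a = b := by
  decide +revert

/-! ### Conflicts between pairs of a relation -/

section Ferrers

variable {α β : Type*}

/-- Two pairs of the relation `E` conflict if exchanging their second coordinates yields two pairs
outside `E`; such pairs do not lie in a common Ferrers relation contained in `E`. -/
def Conflict (E : α → β → Prop) (e f : α × β) : Prop :=
  E e.1 e.2 ∧ E f.1 f.2 ∧ ¬ E e.1 f.2 ∧ ¬ E f.1 e.2

theorem Conflict.symm {E : α → β → Prop} {e f : α × β} (h : Conflict E e f) : Conflict E f e :=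
  ⟨h.2.1, h.1, h.2.2.2, h.2.2.1⟩

/-- Two pairs are linked if they are in the same component of the conflict graph. -/
def Linked (E : α → β → Prop) : α × β → α × β → Prop :=
  Relation.ReflTransGen (Conflict E)

theorem Linked.symm {E : α → β → Prop} {e f : α × β} (h : Linked E e f) : Linked E f e := by
  induction h with
  | refl => exact .refl
  | tail _ h ih => exact .head h.symm ih

/-- A proper 2-coloring of the conflict graph of `E`. The values at pairs outside `E` are
irrelevant. -/
def IsConflictColoring (E : α → β → Prop) (χ : α × β → Bool) : Prop :=
  ∀ e f, Conflict E e f → χ e ≠ χ f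

/-- Three pairs `(xᵢ, yᵢ)` outside `E` such that all `(xᵢ, yⱼ)` with `i ≠ j` are in `E`, and such
that the coloring `χ`, read as a tournament on the three pairs, is a directed triangle. -/
structure CyclicTriple (E : α → β → Prop) (χ : α × β → Bool) (x₁ : α) (y₁ : β) (x₂ : α) (y₂ : β)
    (x₃ : α) (y₃ : β) : Prop where
  n1 : ¬ E x₁ y₁
  n2 : ¬ E x₂ y₂
  n3 : ¬ E x₃ y₃
  e12 : E x₁ y₂
  e21 : E x₂ y₁
  e23 : E x₂ y₃
  e32 : E x₃ y₂
  e31 : E x₃ y₁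
  e13 : E x₁ y₃
  c12 : χ (x₁, y₂) = true
  c23 : χ (x₂, y₃) = true
  c31 : χ (x₃, y₁) = true
  c21 : χ (x₂, y₁) = false
  c32 : χ (x₃, y₂) = false
  c13 : χ (x₁, y₃) = false

namespace CyclicTriple

variable {E : α → β → Prop} {χ : α × β → Bool} {x₁ x₂ x₃ : α} {y₁ y₂ y₃ : β}

theorem rotate (h : CyclicTriple E χ x₁ y₁ x₂ y₂ x₃ y₃) : CyclicTriple E χ x₂ y₂ x₃ y₃ x₁ y₁ :=
  ⟨h.n2, h.n3, h.n1, h.e23, h.e32, h.e31, h.e13, h.e12, h.e21, h.c23, h.c31, h.c12, h.c32, h.c13,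
    h.c21⟩

/-- The pairs `(x₂, y₂)` and `(x₃, y₃)` of a cyclic triple may be replaced by any `(x₂, d)` and
`(c, y₃)` for which `(x₂, y₃)` and `(c, d)` conflict. -/
theorem replace (hχ : IsConflictColoring E χ) (h : CyclicTriple E χ x₁ y₁ x₂ y₂ x₃ y₃) {c : α}
    {d : β} (hcd : E c d) (hd : ¬ E x₂ d) (hc : ¬ E c y₃) :
    CyclicTriple E χ x₁ y₁ x₂ d c y₃ := by
  have k1 := hχ (x₂, y₃) (c, d) ⟨h.e23, hcd, hd, hc⟩
  have ccd : χ (c, d) = false := by simpa [h.c23] using k1.symm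
  have e1 : E x₁ d := by
    by_contra hn
    exact hχ (x₁, y₃) (c, d) ⟨h.e13, hcd, hn, hc⟩ (h.c13.trans ccd.symm)
  have e2 : E c y₁ := by
    by_contra hn
    exact hχ (x₂, y₁) (c, d) ⟨h.e21, hcd, hd, hn⟩ (h.c21.trans ccd.symm)
  have k2 := hχ (x₁, d) (x₂, y₁) ⟨e1, h.e21, h.n1, hd⟩
  have k3 := hχ (c, y₁) (x₁, y₃) ⟨e2, h.e13, hc, h.n1⟩
  exact ⟨h.n1, hd, hc, e1, h.e21, h.e23, hcd, e2, h.e13, by simpa [h.c21] using k2, h.c23,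
    by simpa [h.c13] using k3, h.c21, ccd, h.c13⟩

/-- The companion of `CyclicTriple.replace` that keeps `(x₃, y₂)` instead of `(x₂, y₃)`. -/
theorem replace' (hχ : IsConflictColoring E χ) (h : CyclicTriple E χ x₁ y₁ x₂ y₂ x₃ y₃) {c : α}
    {d : β} (hcd : E c d) (hd : ¬ E x₃ d) (hc : ¬ E c y₂) :
    CyclicTriple E χ x₁ y₁ c y₂ x₃ d := by
  have k1 := hχ (x₃, y₂) (c, d) ⟨h.e32, hcd, hd, hc⟩
  have ccd : χ (c, d) = true := by simpa [h.c32] using k1.symm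
  have e1 : E x₁ d := by
    by_contra hn
    exact hχ (x₁, y₂) (c, d) ⟨h.e12, hcd, hn, hc⟩ (h.c12.trans ccd.symm)
  have e2 : E c y₁ := by
    by_contra hn
    exact hχ (x₃, y₁) (c, d) ⟨h.e31, hcd, hd, hn⟩ (h.c31.trans ccd.symm)
  have k2 := hχ (x₁, d) (x₃, y₁) ⟨e1, h.e31, h.n1, hd⟩
  have k3 := hχ (c, y₁) (x₁, y₂) ⟨e2, h.e12, hc, h.n1⟩
  exact ⟨h.n1, hc, hd, h.e12, e2, hcd, h.e32, h.e31, e1, h.c12, ccd, h.c31,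
    by simpa [h.c12] using k3, h.c32, by simpa [h.c31] using k2⟩

/-- A cyclic triple can be moved, with `(x₁, y₁)` fixed, so that any prescribed pair of the color
`true` in the component of `(x₂, y₃)` takes the place of `(x₂, y₃)`. The component of `(x₁, y₂)`
does not change. -/
theorem exists_of_linked (hχ : IsConflictColoring E χ) (h : CyclicTriple E χ x₁ y₁ x₂ y₂ x₃ y₃)
    {e : α × β} (he : Linked E (x₂, y₃) e) (hc : χ e = true) :
    ∃ c d, CyclicTriple E χ x₁ y₁ e.1 d c e.2 ∧ Linked E (x₁, y₂) (x₁, d) := by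
  -- After an odd number of steps the pair plays the role of `(x₃, y₂)` instead.
  suffices H : (χ e = true ∧ ∃ c d, CyclicTriple E χ x₁ y₁ e.1 d c e.2 ∧
        Linked E (x₁, y₂) (x₁, d)) ∨
      (χ e = false ∧ ∃ c d, CyclicTriple E χ x₁ y₁ c e.2 e.1 d ∧
        Linked E (x₁, y₂) (x₁, e.2)) by
    rcases H with H | H
    · exact H.2
    · simp [hc] at H
  clear hc
  induction he with
  | refl => exact .inl ⟨h.c23, x₃, y₂, h, .refl⟩
  | @tail f g _ hfg ih =>
    obtain ⟨p, q⟩ := f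
    obtain ⟨p', q'⟩ := g
    obtain ⟨-, hg, h1, h2⟩ := hfg
    rcases ih with ⟨-, c, d, t, hl⟩ | ⟨-, c, d, t, hl⟩
    · have t' := t.replace hχ hg h1 h2
      have k1 : Conflict E (x₁, d) (p, y₁) := ⟨t.e12, t.e21, t.n1, t.n2⟩
      have k2 : Conflict E (p, y₁) (x₁, q') := ⟨t'.e21, t'.e12, t'.n2, t'.n1⟩
      exact .inr ⟨t'.c32, p, q, t', (hl.tail k1).tail k2⟩
    · have t' := t.replace' hχ hg h1 h2
      exact .inl ⟨t'.c23, p, q, t', hl⟩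

end CyclicTriple

/-! ### Lexicographic choice of the coloring -/

/-- The colors can be exchanged on components of the conflict graph so that every component has a
pair of color `true` whose first coordinate is least in the component. -/
theorem exists_normalized_coloring {E : α → β → Prop} {χ : α × β → Bool}
    (hχ : IsConflictColoring E χ) (r : α → ℕ) :
    ∃ χ' : α × β → Bool, IsConflictColoring E χ' ∧
      ∀ e, ∃ m, Linked E e m ∧ χ' m = true ∧ ∀ f, Linked E e f → r m.1 ≤ r f.1 := by
  let s : Setoid (α × β) := ⟨Linked E, fun _ => .refl, Linked.symm, Relation.ReflTransGen.trans⟩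
  have hm : ∀ q : Quotient s, ∃ m : α × β, Quotient.mk s m = q ∧
      ∀ f, Quotient.mk s f = q → r m.1 ≤ r f.1 := by
    intro q
    obtain ⟨m, hm, hmin⟩ := (measure fun e : α × β => r e.1).wf.has_min
      {e | Quotient.mk s e = q} (Quotient.exists_rep q)
    exact ⟨m, hm, fun f hf => not_lt.1 (hmin f hf)⟩
  choose m hm hmin using hm
  refine ⟨fun e => χ e == χ (m (Quotient.mk s e)), fun e f hef => ?_, fun e => ?_⟩
  · have hq : Quotient.mk s e = Quotient.mk s f := Quotient.sound (.single hef)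
    simp only [hq]
    exact fun h => hχ e f hef (Bool.beq_left_injective _ h)
  · refine ⟨m (Quotient.mk s e), (Quotient.exact (hm _)).symm, ?_, fun f hf => ?_⟩
    · simp [hm]
    · exact hmin _ f (Quotient.sound hf.symm)

/-- In a cyclic triple, no pair of color `true` at `x₁` lies in the component of `(x₃, y₁)`,
although `(x₁, y₃)` lies there: otherwise the triple could be moved so that `(x₁, y₂)` gets the
color `false`. If `x₁` is least among the first coordinates in the components of the triple, which
can be arranged by moving the triple, this contradicts the normalization of the coloring. -/
theorem not_cyclicTriple_of_normalized {E : α → β → Prop} {χ : α × β → Bool}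
    (hχ : IsConflictColoring E χ) {r : α → ℕ} (hr : Function.Injective r)
    (hmin : ∀ e, ∃ m, Linked E e m ∧ χ m = true ∧ ∀ f, Linked E e f → r m.1 ≤ r f.1)
    {x₁ x₂ x₃ : α} {y₁ y₂ y₃ : β} : ¬ CyclicTriple E χ x₁ y₁ x₂ y₂ x₃ y₃ := by
  choose m hm hmc hmin using hmin
  have key : ∀ {x₁ x₂ x₃ : α} {y₁ y₂ y₃ : β}, CyclicTriple E χ x₁ y₁ x₂ y₂ x₃ y₃ →
      r (m (x₁, y₂)).1 ≤ r (m (x₃, y₁)).1 → False := by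
    intro x₁ x₂ x₃ y₁ y₂ y₃ h hle
    obtain ⟨c, d, t, hl⟩ := h.rotate.rotate.exists_of_linked hχ (hm _) (hmc _)
    have hl' : Linked E (x₃, y₁) ((m (x₁, y₂)).1, y₃) :=
      hl.tail ⟨t.e12, t.e21, t.n1, t.n2⟩
    have hx : (m (x₃, y₁)).1 = (m (x₁, y₂)).1 := hr (le_antisymm (hmin _ ((m (x₁, y₂)).1, y₃) hl') hle)
    obtain ⟨c', d', t', -⟩ := t.rotate.rotate.exists_of_linked hχ (hl.symm.trans (hm _)) (hmc _)
    -- The moved triples give opposite colors to the same pair.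
    have h1 := t'.c21
    have h2 := t.c23
    rw [hx] at h1
    exact absurd (h1.symm.trans h2) Bool.false_ne_true
  intro h
  by_cases h1 : r (m (x₁, y₂)).1 ≤ r (m (x₃, y₁)).1
  · exact key h h1
  by_cases h2 : r (m (x₂, y₃)).1 ≤ r (m (x₁, y₂)).1
  · exact key h.rotate h2
  · exact key h.rotate.rotate (by omega)

/-! ### Ferrers dimension two -/

/-- The pairs of `E` that conflict with no pair of color `i` can be separated from the pairs outside
`E` by thresholds, if there is no cyclic triple. -/
theorem exists_thresholds [Finite α] {E : α → β → Prop} {χ : α × β → Bool}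
    (hχ : IsConflictColoring E χ)
    (hc : ∀ x₁ y₁ x₂ y₂ x₃ y₃, ¬ CyclicTriple E χ x₁ y₁ x₂ y₂ x₃ y₃) (i : Bool) :
    ∃ (l : α → ℕ) (L : β → ℕ), (∀ a b, ¬ E a b → l a < L b) ∧
      ∀ a b, E a b → (∀ f, Conflict E (a, b) f → χ f ≠ i) → L b ≤ l a := by
  classical
  let S : α → β → Prop := fun a b => E a b ∧ ∀ f, Conflict E (a, b) f → χ f ≠ i
  let R : α → α → Prop := fun a a' => ∃ b, ¬ E a b ∧ S a' b
  have hirr : ∀ a, ¬ R a a := fun a ⟨b, h, h'⟩ => h h'.1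
  have htrans : ∀ a a' a'', R a a' → R a' a'' → R a a'' := by
    rintro a a' a'' ⟨b, hab, hb⟩ ⟨b', hab', hb'⟩
    have conflict_ne : ∀ {e f : α × β}, Conflict E e f → S e.1 e.2 → S f.1 f.2 → False := by
      intro e f hef he hf
      exact hχ e f hef (Bool.eq_of_ne_of_ne (hf.2 e hef.symm) (he.2 f hef))
    have h1 : E a'' b := by
      by_contra hn
      exact conflict_ne (e := (a', b)) (f := (a'', b')) ⟨hb.1, hb'.1, hab', hn⟩ hb hb'
    by_cases h2 : S a'' b
    · exact ⟨b, hab, h2⟩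
    exfalso
    -- A pair `(c, d)` of color `i` in conflict with `(a'', b)` closes a directed triangle.
    have h3 : ∃ f, Conflict E (a'', b) f ∧ χ f = i := by
      by_contra hn
      push Not at hn
      exact h2 ⟨h1, hn⟩
    obtain ⟨⟨c, d⟩, ⟨-, hcd, had, hcb⟩, hcol⟩ := h3
    have k1 : E a' d := by
      by_contra hn
      exact hb.2 (c, d) ⟨hb.1, hcd, hn, hcb⟩ hcol
    have k2 : E c b' := by
      by_contra hn
      exact hb'.2 (c, d) ⟨hb'.1, hcd, had, hn⟩ hcol
    have q1 := hχ (a'', b) (c, d) ⟨h1, hcd, had, hcb⟩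
    have q2 := hχ (a', d) (a'', b') ⟨k1, hb'.1, hab', had⟩
    have q3 := hχ (a', b) (c, b') ⟨hb.1, k2, hab', hcb⟩
    have q4 := hb.2 (c, b') ⟨hb.1, k2, hab', hcb⟩
    have q5 := hb'.2 (a', d) ⟨hb'.1, k1, had, hab'⟩
    have c1 : χ (a'', b) = !i := Bool.eq_not.2 (hcol ▸ q1)
    have c2 : χ (a', d) = !i := Bool.eq_not.2 q5
    have c3 : χ (c, b') = !i := Bool.eq_not.2 q4
    have c4 : χ (a', b) = i := Bool.eq_of_ne_of_ne q3 q4.symm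
    have c5 : χ (a'', b') = i := Bool.eq_of_ne_of_ne q2.symm q5.symm
    cases i
    · exact hc c b a' b' a'' d ⟨hcb, hab', had, k2, hb.1, k1, hb'.1, h1, hcd,
        c3, c2, c1, c4, c5, hcol⟩
    · -- For the color `true` the triangle is traversed in the opposite direction.
      exact hc c b a'' d a' b' ⟨hcb, had, hab', hcd, h1, hb'.1, k1, hb.1, k2,
        hcol, c5, c4, c1, c2, c3⟩
  have := Fintype.ofFinite α
  let l : α → ℕ := fun a => (Finset.univ.filter fun x => R x a).card
  have hl : ∀ a a', R a a' → l a < l a' := by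
    intro a a' h
    apply Finset.card_lt_card
    rw [Finset.ssubset_iff_of_subset]
    · exact ⟨a, by simpa using h, by simpa using hirr a⟩
    · intro x hx
      simp only [Finset.mem_filter, Finset.mem_univ, true_and] at hx ⊢
      exact htrans _ _ _ hx h
  refine ⟨l, fun b => (Finset.univ.filter fun a => ¬ E a b).sup fun a => l a + 1,
    fun a b hab => ?_, fun a b hab hS => ?_⟩
  · exact Finset.le_sup (f := fun a => l a + 1) (by simpa using hab)
  · refine Finset.sup_le fun x hx => hl x a ⟨b, by simpa using hx, hab, hS⟩

/-- **Cogis' theorem**: a relation whose conflict graph is 2-colorable is the union of two Ferrers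
relations. A Ferrers relation is given here by comparing values of two functions. -/
theorem exists_two_threshold_representation [Finite α] {E : α → β → Prop} {χ : α × β → Bool}
    (hχ : IsConflictColoring E χ) :
    ∃ (l r : α → ℕ) (L R : β → ℕ), ∀ a b, E a b ↔ L b ≤ l a ∨ R b ≤ r a := by
  obtain ⟨rk, hrk⟩ := exists_injective_nat α
  obtain ⟨χ', hχ', hmin⟩ := exists_normalized_coloring hχ rk
  have hc : ∀ x₁ y₁ x₂ y₂ x₃ y₃, ¬ CyclicTriple E χ' x₁ y₁ x₂ y₂ x₃ y₃ :=
    fun _ _ _ _ _ _ => not_cyclicTriple_of_normalized hχ' hrk hmin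
  obtain ⟨l, L, hl, hL⟩ := exists_thresholds hχ' hc false
  obtain ⟨r, R, hr, hR⟩ := exists_thresholds hχ' hc true
  refine ⟨l, r, L, R, fun a b => ⟨fun hab => ?_, fun h => ?_⟩⟩
  · cases hcol : χ' (a, b)
    · exact .inl (hL a b hab fun f hf => hcol ▸ (hχ' _ f hf).symm)
    · exact .inr (hR a b hab fun f hf => hcol ▸ (hχ' _ f hf).symm)
  · by_contra hab
    have h1 := hl a b hab
    have h2 := hr a b hab
    omega

end Ferrers

/-! ### Arcs on the circle -/

theorem UnitAddCircle.coe_eq_coe_iff {x y : ℝ} :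
    (x : UnitAddCircle) = (y : UnitAddCircle) ↔ ∃ n : ℤ, y = x + n := by
  rw [eq_comm, ← sub_eq_zero, ← AddCircle.coe_sub, AddCircle.coe_eq_zero_iff]
  simp only [zsmul_eq_mul, mul_one]
  exact exists_congr fun n => ⟨fun h => by linarith, fun h => by linarith⟩

/-- Two closed arcs that meet have the last point of one of them in common. -/
theorem last_mem_of_arcs_inter_nonempty {a b a' b' : ℝ}
    (h : ((fun x : ℝ => (x : UnitAddCircle)) '' Set.Icc a b ∩
      (fun x : ℝ => (x : UnitAddCircle)) '' Set.Icc a' b').Nonempty) :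
    (b : UnitAddCircle) ∈ (fun x : ℝ => (x : UnitAddCircle)) '' Set.Icc a' b' ∨
      (b' : UnitAddCircle) ∈ (fun x : ℝ => (x : UnitAddCircle)) '' Set.Icc a b := by
  obtain ⟨_, ⟨x, ⟨hx, hx'⟩, rfl⟩, ⟨y, ⟨hy, hy'⟩, hxy⟩⟩ := h
  obtain ⟨n, rfl⟩ := UnitAddCircle.coe_eq_coe_iff.1 hxy.symm
  rcases le_total (b + n) b' with h | h
  · exact .inl ⟨b + n, ⟨by linarith, h⟩, (UnitAddCircle.coe_eq_coe_iff.2 ⟨n, rfl⟩).symm⟩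
  · exact .inr ⟨b' - n, ⟨by linarith, by linarith⟩,
      UnitAddCircle.coe_eq_coe_iff.2 ⟨n, by ring⟩⟩

/-- An arc around `0` and an arc around `1/2` meet if and only if they do so on one of the two
half-circles. -/
theorem arcs_inter_nonempty_iff {s t s' t' : ℝ} (hs : 0 ≤ s) (ht : 0 ≤ t) (hs' : 0 ≤ s')
    (ht' : 0 ≤ t') (hs2 : s < 1 / 2) (ht2 : t < 1 / 2) (hs2' : s' < 1 / 2) (ht2' : t' < 1 / 2) :
    ((fun x : ℝ => (x : UnitAddCircle)) '' Set.Icc (-s) t ∩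
      (fun x : ℝ => (x : UnitAddCircle)) '' Set.Icc t' (1 - s')).Nonempty ↔ s' ≤ s ∨ t' ≤ t := by
  constructor
  · rintro ⟨_, ⟨x, ⟨hx, hx'⟩, rfl⟩, ⟨y, ⟨hy, hy'⟩, hxy⟩⟩
    obtain ⟨n, rfl⟩ := UnitAddCircle.coe_eq_coe_iff.1 hxy.symm
    have h1 : (-1 : ℝ) < n := by linarith
    have h2 : (n : ℝ) < 2 := by linarith
    have h3 : -1 < n := by exact_mod_cast h1
    have h4 : n < 2 := by exact_mod_cast h2
    obtain rfl | rfl : n = 0 ∨ n = 1 := by omega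
    · right; push_cast at *; linarith
    · left; push_cast at *; linarith
  · rintro (h | h)
    · exact ⟨((-s : ℝ) : UnitAddCircle), ⟨-s, ⟨le_rfl, by linarith⟩, rfl⟩,
        ⟨1 - s, ⟨by linarith, by linarith⟩,
          (UnitAddCircle.coe_eq_coe_iff.2 ⟨1, by push_cast; ring⟩).symm⟩⟩
    · exact ⟨(t : UnitAddCircle), ⟨t, ⟨by linarith, le_rfl⟩, rfl⟩,
        ⟨t, ⟨h, by linarith⟩, rfl⟩⟩

/-! ### The three implications -/

theorem SimpleGraph.IsCircularArc.isOnePerfectlyOrientable {V : Type*} {G : SimpleGraph V}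
    (h : G.IsCircularArc) : G.IsOnePerfectlyOrientable := by
  obtain ⟨A, hA, hG⟩ := h
  choose a b hab hA using hA
  let R : V → V → Prop := fun u v => u ≠ v ∧ (b u : UnitAddCircle) ∈ A v
  have hmem : ∀ u, (b u : UnitAddCircle) ∈ A u := fun u => by
    rw [hA]
    exact ⟨b u, ⟨hab u, le_rfl⟩, rfl⟩
  have hadj : ∀ u v, G.Adj u v ↔ R u v ∨ R v u := by
    intro u v
    constructor
    · intro huv
      have h1 := (hG u v huv.ne).1 huv
      rw [hA u, hA v] at h1
      refine (last_mem_of_arcs_inter_nonempty h1).imp (fun h => ⟨huv.ne, ?_⟩)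
        fun h => ⟨huv.ne', ?_⟩
      · rwa [hA v]
      · rwa [hA u]
    · rintro (⟨hne, h⟩ | ⟨hne, h⟩)
      · exact (hG u v hne).2 ⟨_, hmem u, h⟩
      · exact ((hG v u hne).2 ⟨_, hmem v, h⟩).symm
  -- When each of two arcs contains the last point of the other, a well-order breaks the tie.
  let D : Digraph V := ⟨fun u v => R u v ∧ (R v u → WellOrderingRel u v)⟩
  have hD : D.IsOrientationOf G := by
    refine ⟨fun u v => ?_, fun u v h h' => ?_⟩
    · rw [hadj]
      constructor
      · intro h
        have hne : u ≠ v := h.elim (fun h => h.1) fun h => h.1.symm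
        have := trichotomous_of (WellOrderingRel (α := V)) u v
        change (R u v ∧ _) ∨ (R v u ∧ _)
        tauto
      · exact Or.imp (fun h => h.1) fun h => h.1
    · exact asymm (h.2 h'.1) (h'.2 h.1)
  refine ⟨D, hD, fun v => ⟨fun x y => ?_, fun x y => hD.2 x y⟩⟩
  rw [SimpleGraph.top_adj]
  refine Iff.trans ⟨fun hne => ?_, fun hxy => ?_⟩ (hD.1 x y)
  · exact (hG x y fun h => hne (Subtype.ext h)).2 ⟨_, x.2.1.2, y.2.1.2⟩
  · exact fun h => hxy.ne (congrArg Subtype.val h)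

theorem exists_cyclic_orientation_of_isOnePerfectlyOrientable {V : Type*} {G : SimpleGraph V}
    (h : G.IsOnePerfectlyOrientable) : ∃ D : Digraph V, D.IsOrientationOf G ∧
      ∀ f : SimpleGraph.cycleGraph 4 ↪g G, SimpleGraph.IsCyclicallyOriented f D := by
  obtain ⟨D, hD, hT⟩ := h
  refine ⟨D, hD, fun f => ?_⟩
  have hadj : ∀ i j, (SimpleGraph.cycleGraph 4).Adj i j ↔ D.Adj (f i) (f j) ∨ D.Adj (f j) (f i) :=
    fun i j => f.map_adj_iff.symm.trans (hD.1 _ _)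
  have hasymm : ∀ i j, D.Adj (f i) (f j) → ¬ D.Adj (f j) (f i) := fun i j => hD.2 _ _
  have huniq : ∀ i j k, D.Adj (f i) (f j) → D.Adj (f i) (f k) → j ≠ k →
      (SimpleGraph.cycleGraph 4).Adj j k := by
    intro i j k hj hk hne
    rw [hadj]
    refine ((hT (f i)).1 ⟨f j, hj⟩ ⟨f k, hk⟩).1 ?_
    rw [SimpleGraph.top_adj]
    exact fun h => hne (f.injective (congrArg Subtype.val h))
  generalize hP : (fun i j => D.Adj (f i) (f j)) = P
  have hP' : ∀ i j, D.Adj (f i) (f j) = P i j := fun i j => congrFun (congrFun hP i) j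
  simp only [hP'] at hadj hasymm huniq
  intro i
  simp only [hP']
  have e1 : (SimpleGraph.cycleGraph 4).Adj i (i + 1) := by revert i; decide
  have e2 : (SimpleGraph.cycleGraph 4).Adj (i + 1) (i + 2) := by revert i; decide
  have e3 : (SimpleGraph.cycleGraph 4).Adj (i + 2) (i + 3) := by revert i; decide
  have e4 : (SimpleGraph.cycleGraph 4).Adj (i + 3) i := by revert i; decide
  have n1 : ¬ (SimpleGraph.cycleGraph 4).Adj i (i + 2) := by revert i; decide
  have n2 : ¬ (SimpleGraph.cycleGraph 4).Adj (i + 1) (i + 3) := by revert i; decide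
  have d1 : i ≠ i + 2 := by revert i; decide
  have d2 : i + 1 ≠ i + 3 := by revert i; decide
  have hcases : ∀ j, j = i ∨ j = i + 1 ∨ j = i + 2 ∨ j = i + 3 := by revert i; decide
  have hex : P i (i + 1) ∨ P i (i + 3) := by
    -- Otherwise `i + 1` and `i + 3` both point to `i`, and `i + 2` has to point to both of them.
    by_contra hn
    push Not at hn
    have q1 : P (i + 1) i := ((hadj _ _).1 e1).resolve_left hn.1
    have q3 : P (i + 3) i := ((hadj _ _).1 e4).resolve_right hn.2
    have q2 : P (i + 2) (i + 1) :=
      ((hadj _ _).1 e2).resolve_left fun h => n1 (huniq _ _ _ q1 h d1)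
    have q4 : P (i + 2) (i + 3) :=
      ((hadj _ _).1 e3).resolve_right fun h => n1 (huniq _ _ _ q3 h d1)
    exact n2 (huniq _ _ _ q2 q4 d2)
  have hni : ¬ P i i := fun h => hasymm _ _ h h
  have hn2 : ¬ P i (i + 2) := fun h => n1 ((hadj _ _).2 (.inl h))
  have hun : ¬ (P i (i + 1) ∧ P i (i + 3)) := fun h => n2 (huniq _ _ _ h.1 h.2 d2)
  rcases hex with h | h
  · refine ⟨i + 1, h, fun j hj => ?_⟩
    rcases hcases j with rfl | rfl | rfl | rfl <;> tauto
  · refine ⟨i + 3, h, fun j hj => ?_⟩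
    rcases hcases j with rfl | rfl | rfl | rfl <;> tauto

/-- On an induced 4-cycle `a, b, b', a'` that is oriented cyclically, exactly one of the opposite
edges `ab` and `a'b'` is directed from `a` to `b` or from `a'` to `b'`. -/
theorem orientation_ne_of_conflict {V : Type*} {G : SimpleGraph V} {D : Digraph V}
    (hD : D.IsOrientationOf G)
    (hC : ∀ f : SimpleGraph.cycleGraph 4 ↪g G, SimpleGraph.IsCyclicallyOriented f D)
    {a b a' b' : V} (hab : G.Adj a b) (hab' : G.Adj a' b') (haa : G.Adj a a') (hbb : G.Adj b b')
    (h1 : ¬ G.Adj a b') (h2 : ¬ G.Adj a' b) (hne : a ≠ b') (hne' : a' ≠ b) :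
    ¬ (D.Adj a b ↔ D.Adj a' b') := by
  have hinj : Function.Injective ![a, b, b', a'] := by
    have := hab.ne
    have := hab'.ne
    have := haa.ne
    have := hbb.ne
    intro i j hij
    fin_cases i <;> fin_cases j <;> simp at hij ⊢ <;> grind
  have hmap : ∀ {i j}, G.Adj (![a, b, b', a'] i) (![a, b, b', a'] j) ↔
      (SimpleGraph.cycleGraph 4).Adj i j := by
    intro i j
    have hdec : ∀ i j : Fin 4, (SimpleGraph.cycleGraph 4).Adj i j ↔ j = i + 1 ∨ i = j + 1 := by
      decide
    rw [hdec]
    have := hab.symm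
    have := hab'.symm
    have := haa.symm
    have := hbb.symm
    have := mt G.adj_symm h1
    have := mt G.adj_symm h2
    fin_cases i <;> fin_cases j <;> simp [*]
  have hcyc := hC ⟨⟨![a, b, b', a'], hinj⟩, hmap⟩
  have hout : ∀ i : Fin 4, ∃! j : Fin 4, D.Adj (![a, b, b', a'] i) (![a, b, b', a'] j) := hcyc
  have hG : ∀ {u v}, D.Adj u v → G.Adj u v := fun h => (hD.1 _ _).2 (.inl h)
  -- Each vertex points to one of its two neighbors on the cycle.
  have oa : D.Adj a b ∨ D.Adj a a' := by
    obtain ⟨j, hj, -⟩ := hout 0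
    have := fun h : D.Adj a a => (hG h).ne rfl
    have := fun h : D.Adj a b' => h1 (hG h)
    fin_cases j <;> simp at hj <;> tauto
  have ob : D.Adj b a ∨ D.Adj b b' := by
    obtain ⟨j, hj, -⟩ := hout 1
    have := fun h : D.Adj b b => (hG h).ne rfl
    have := fun h : D.Adj b a' => h2 (hG h).symm
    fin_cases j <;> simp at hj <;> tauto
  have ob' : D.Adj b' b ∨ D.Adj b' a' := by
    obtain ⟨j, hj, -⟩ := hout 2
    have := fun h : D.Adj b' b' => (hG h).ne rfl
    have := fun h : D.Adj b' a => h1 (hG h).symm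
    fin_cases j <;> simp at hj <;> tauto
  have oa' : D.Adj a' a ∨ D.Adj a' b' := by
    obtain ⟨j, hj, -⟩ := hout 3
    have := fun h : D.Adj a' a' => (hG h).ne rfl
    have := fun h : D.Adj a' b => h2 (hG h)
    fin_cases j <;> simp at hj <;> tauto
  have s1 := hD.2 a b
  have s2 := hD.2 a' b'
  have s3 := hD.2 a a'
  have s4 := hD.2 b b'
  tauto

/-- Two cliques whose mutual adjacency is a union of two Ferrers relations form a circular arc
graph. -/
theorem isCircularArc_of_threshold_representation {V : Type*} {G : SimpleGraph V} (c : V → Fin 2)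
    (hc : ∀ u v, u ≠ v → c u = c v → G.Adj u v) {l r : {v // c v = 0} → ℕ}
    {L R : {v // c v ≠ 0} → ℕ} (h : ∀ a b, G.Adj a.1 b.1 ↔ L b ≤ l a ∨ R b ≤ r a) :
    G.IsCircularArc := by
  -- Any strictly increasing map of `ℕ` into `[0, 1/2)` turns the thresholds into lengths.
  let φ : ℕ → ℝ := fun n => 1 / 2 - 1 / ((n : ℝ) + 2)
  have hφ : StrictMono φ := fun m n hmn => by
    have : (m : ℝ) < n := by exact_mod_cast hmn
    exact sub_lt_sub_left (one_div_lt_one_div_of_lt (by positivity) (by linarith)) _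
  have h0 : ∀ n, 0 ≤ φ n := fun n =>
    sub_nonneg.2 (one_div_le_one_div_of_le (by norm_num) (by simp))
  have h2 : ∀ n, φ n < 1 / 2 := fun n => sub_lt_self _ (by positivity)
  let A : V → Set UnitAddCircle := fun v =>
    if hv : c v = 0 then
      (fun x : ℝ => (x : UnitAddCircle)) '' Set.Icc (-φ (l ⟨v, hv⟩)) (φ (r ⟨v, hv⟩))
    else (fun x : ℝ => (x : UnitAddCircle)) '' Set.Icc (φ (R ⟨v, hv⟩)) (1 - φ (L ⟨v, hv⟩))
  have hA0 : ∀ v (hv : c v = 0), A v =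
      (fun x : ℝ => (x : UnitAddCircle)) '' Set.Icc (-φ (l ⟨v, hv⟩)) (φ (r ⟨v, hv⟩)) :=
    fun v hv => dif_pos hv
  have hA1 : ∀ v (hv : c v ≠ 0), A v =
      (fun x : ℝ => (x : UnitAddCircle)) '' Set.Icc (φ (R ⟨v, hv⟩)) (1 - φ (L ⟨v, hv⟩)) :=
    fun v hv => dif_neg hv
  have hcross : ∀ u v, c u = 0 → c v ≠ 0 → (G.Adj u v ↔ (A u ∩ A v).Nonempty) := by
    intro u v hu hv
    rw [hA0 u hu, hA1 v hv, arcs_inter_nonempty_iff (h0 _) (h0 _) (h0 _) (h0 _) (h2 _) (h2 _)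
      (h2 _) (h2 _), hφ.le_iff_le, hφ.le_iff_le]
    exact h ⟨u, hu⟩ ⟨v, hv⟩
  have hzero : ∀ v, c v = 0 → ((0 : ℝ) : UnitAddCircle) ∈ A v := fun v hv => by
    rw [hA0 v hv]
    exact ⟨0, ⟨neg_nonpos.2 (h0 _), h0 _⟩, rfl⟩
  have hhalf : ∀ v, c v ≠ 0 → ((1 / 2 : ℝ) : UnitAddCircle) ∈ A v := fun v hv => by
    rw [hA1 v hv]
    exact ⟨1 / 2, ⟨(h2 _).le, by linarith [h2 (L ⟨v, hv⟩)]⟩, rfl⟩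
  refine ⟨A, fun v => ?_, fun u v hne => ?_⟩
  · by_cases hv : c v = 0
    · exact ⟨_, _, (neg_nonpos.2 (h0 _)).trans (h0 _), hA0 v hv⟩
    · exact ⟨_, _, by linarith [h2 (R ⟨v, hv⟩), h2 (L ⟨v, hv⟩)], hA1 v hv⟩
  · by_cases hu : c u = 0 <;> by_cases hv : c v = 0
    · exact iff_of_true (hc u v hne (hu.trans hv.symm)) ⟨_, hzero u hu, hzero v hv⟩
    · exact hcross u v hu hv
    · rw [G.adj_comm, Set.inter_comm]
      exact hcross v u hv hu
    · exact iff_of_true (hc u v hne (by omega)) ⟨_, hhalf u hu, hhalf v hv⟩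

theorem theorem5p3 {V : Type*} [Finite V] (G : SimpleGraph V) (hG : G.IsCoBipartite) :
    List.TFAE [
      G.IsOnePerfectlyOrientable,
      ∃ D : Digraph V, D.IsOrientationOf G ∧
        ∀ f : SimpleGraph.cycleGraph 4 ↪g G, SimpleGraph.IsCyclicallyOriented f D,
      G.IsCircularArc] := by
  tfae_have 1 → 2 := exists_cyclic_orientation_of_isOnePerfectlyOrientable
  tfae_have 3 → 1 := SimpleGraph.IsCircularArc.isOnePerfectlyOrientable
  tfae_have 2 → 3 := by
    classical
    rintro ⟨D, hD, hC⟩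
    obtain ⟨c⟩ := hG
    have hc : ∀ u v, u ≠ v → c u = c v → G.Adj u v := by
      intro u v hne huv
      by_contra hn
      exact c.valid ((SimpleGraph.compl_adj G u v).2 ⟨hne, hn⟩) huv
    let E : {v // c v = 0} → {v // c v ≠ 0} → Prop := fun a b => G.Adj a.1 b.1
    have hχ : IsConflictColoring E fun e => decide (D.Adj e.1.1 e.2.1) := by
      rintro ⟨⟨a, ha⟩, ⟨b, hb⟩⟩ ⟨⟨a', ha'⟩, ⟨b', hb'⟩⟩ ⟨h1, h2, h3, h4⟩
      change G.Adj a b at h1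
      change G.Adj a' b' at h2
      change ¬ G.Adj a b' at h3
      change ¬ G.Adj a' b at h4
      have haa : a ≠ a' := by rintro rfl; exact h3 h2
      have hbb : b ≠ b' := by rintro rfl; exact h3 h1
      have key := orientation_ne_of_conflict hD hC h1 h2 (hc a a' haa (ha.trans ha'.symm))
        (hc b b' hbb (by omega)) h3 h4 (by rintro rfl; exact hb' ha) (by rintro rfl; exact hb ha')
      simpa [decide_eq_decide] using key
    obtain ⟨l, r, L, R, h⟩ := exists_two_threshold_representation hχ
    exact isCircularArc_of_threshold_representation c hc h
  tfae_finish
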